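/- Let $N\ge 2$ and $[N]$ be a set of $N$ elements. For a relation $R\subseteq[N]\times[N]$ put $R_x=\{y:(x,y)\in R\}$, $R^{\mathrm{inv}}_y=\{x:(x,y)\in R\}$ and $r_{\max}(R)=\max\{\max_x|R_x|,\max_y|R^{\mathrm{inv}}_y|\}$. A quantum algorithm $\mathcal A$ with $q$ queries to a permutation $\pi$ of $[N]$ and its inverse has a direction bit, a query register over $[N]$, an answer register over a finite abelian group $Y$ with a fixed injective encoding $\mathrm{enc}:[N]\to Y$ (for instance bit strings with bitwise XOR, or $\mathbb Z/N$ with addition), and an arbitrary finite workspace. It starts in a fixed computational basis state, applies $q+1$ arbitrary fixed unitaries interleaved with $q$ applications of $$U_\pi|0\rangle|x\rangle|y\rangle=|0\rangle|x\rangle|y+\mathrm{enc}(\pi(x))\rangle,\qquad U_\pi|1\rangle|x\rangle|y\rangle=|1\rangle|x\rangle|y+\mathrm{enc}(\pi^{-1}(x))\rangle,$$ and finally measures in the computational basis and computes an output $x\in[N]$ from the outcome. (1) For every $N\ge 2$, every encoding, every $R\subseteq[N]\times[N]$, every $q\ge 0$ and every such $\mathcal A$, with $\pi$ a uniformly random permutation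 of $[N]$, $$\Pr_{\pi}\left[(x,\pi(x))\in R : x\leftarrow\mathcal A^{\pi}\right]\le\frac{8\,(8q+1)^2\,r_{\max}(R)}{N}.$$ (2) This is tight up to a constant factor: there is an absolute constant $c>0$ such that for all $N\ge 2$ and all integers $0\le r\le N$ there is a relation $R\subseteq[N]\times[N]$ with $r_{\max}(R)=r$ such that for every encoding and every $q\ge 0$ some algorithm $\mathcal A$ with $q$ queries satisfies $$\Pr_{\pi}\left[(x,\pi(x))\in R : x\leftarrow\mathcal A^{\pi}\right]\ge c\cdot\min\left\{1,\frac{8\,(8q+1)^2\,r}{N}\right\}.$$ -/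

import Mathlib

open Finset

namespace PermSearch

/-- Row `R_x = {y : (x, y) ∈ R}` of a relation on `[N]`. -/
def row {N : ℕ} (R : Finset (Fin N × Fin N)) (x : Fin N) : Finset (Fin N) :=
  univ.filter fun y => (x, y) ∈ R

/-- Column `R_y^inv = {x : (x, y) ∈ R}` of a relation on `[N]`. -/
def col {N : ℕ} (R : Finset (Fin N × Fin N)) (y : Fin N) : Finset (Fin N) :=
  univ.filter fun x => (x, y) ∈ R

/-- `r_max`, the largest size of a row or of a column of `R`. -/
def rMax {N : ℕ} (R : Finset (Fin N × Fin N)) : ℕ :=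
  max (univ.sup fun x => (row R x).card) (univ.sup fun y => (col R y).card)

/-- The labels of the computational basis: a direction bit `b` (`false` for a query to `π`,
`true` for a query to `π⁻¹`), a query register over `[N]`, an answer register over `Y`, and a
workspace register over `W`. -/
abbrev Label (N : ℕ) (Y W : Type) : Type := Bool × Fin N × Y × W

/-- One query on basis labels: `(b, x, y, w) ↦ (b, x, y + enc (π^{±1} x), w)`. Elements of `[N]` are
written into the answer register through the encoding `enc`: the group `Y = (ZMod 2)^n` gives
bitwise XOR, the group `Y = ZMod N` gives addition modulo `N`. -/
def queryLabel {N : ℕ} {Y W : Type} [AddCommGroup Y] (enc : Fin N ↪ Y)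
    (π : Equiv.Perm (Fin N)) : Label N Y W → Label N Y W
  | (false, x, y, w) => (false, x, y + enc (π x), w)
  | (true, x, y, w) => (true, x, y + enc (π.symm x), w)

/-- The query unitary `U_π` (tensored with the identity on the workspace), which sends the basis
vector `j` to the basis vector `queryLabel enc π j`. -/
def oracle {N : ℕ} {Y W : Type} [AddCommGroup Y] [DecidableEq Y] [DecidableEq W]
    (enc : Fin N ↪ Y) (π : Equiv.Perm (Fin N)) : Matrix (Label N Y W) (Label N Y W) ℂ :=
  Matrix.of fun i j => if i = queryLabel enc π j then 1 else 0

/-- A quantum algorithm with `q` queries: a finite workspace, an initial basis state, `q + 1`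
arbitrary unitaries (before, between and after the queries) independent of the oracle, and
a final measurement in the computational basis whose outcome is mapped to an element of `[N]`. -/
structure QueryAlgorithm (N : ℕ) (Y : Type) [Fintype Y] [DecidableEq Y] (q : ℕ) where
  Work : Type
  [fintypeWork : Fintype Work]
  [decidableEqWork : DecidableEq Work]
  start : Label N Y Work
  unitaryOp : Fin (q + 1) → Matrix.unitaryGroup (Label N Y Work) ℂ
  out : Label N Y Work → Fin N

attribute [instance] QueryAlgorithm.fintypeWork QueryAlgorithm.decidableEqWork

namespace QueryAlgorithm

variable {N : ℕ} {Y : Type} [AddCommGroup Y] [Fintype Y] [DecidableEq Y] {q : ℕ}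

/-- The state vector after `k` queries and the unitary that follows them:
`V_k U_π V_{k-1} ⋯ U_π V_0 |start⟩`, for `k = 0, …, q`. -/
noncomputable def state (A : QueryAlgorithm N Y q) (enc : Fin N ↪ Y) (π : Equiv.Perm (Fin N)) :
    Fin (q + 1) → (Label N Y A.Work → ℂ) :=
  Fin.induction ((A.unitaryOp 0).1.mulVec (Pi.single A.start 1))
    fun i ψ => (A.unitaryOp i.succ).1.mulVec ((oracle enc π).mulVec ψ)

/-- The probability that `A` with oracle `π`, `π⁻¹` outputs `x`. -/
noncomputable def outputProb (A : QueryAlgorithm N Y q) (enc : Fin N ↪ Y)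
    (π : Equiv.Perm (Fin N)) (x : Fin N) : ℝ :=
  ∑ s ∈ univ.filter (fun s => A.out s = x), ‖A.state enc π (Fin.last q) s‖ ^ 2

/-- The probability, over a uniformly random permutation `π` of `[N]` and the measurement of `A`,
that the output `x` of `A` satisfies `(x, π x) ∈ R`. -/
noncomputable def successProb (A : QueryAlgorithm N Y q) (enc : Fin N ↪ Y)
    (R : Finset (Fin N × Fin N)) : ℝ :=
  (∑ π : Equiv.Perm (Fin N),
    ∑ x ∈ univ.filter (fun x => (x, π x) ∈ R), A.outputProb enc π x) /
      (Fintype.card (Equiv.Perm (Fin N)) : ℝ)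

end QueryAlgorithm

end PermSearch

/-! Upper bound: reprogramming combined with the hybrid argument. Success splits over the pairs `p`
in `R` into the events that `p.1` is output and `π p.1 = p.2`. Conditioning on `π p.1 = p.2` has
probability `1 / N` and amounts to running on `redirect p σ` for a uniform `σ` (`sum_redirect`), so
`N` times the success probability is the mean over `σ` of `∑ p ∈ R, Pr[output p.1 under redirect p
σ]`. The run on `redirect p σ` is compared with the run on `σ`, which does not depend on `p`. A
basis query sees the change only if `p` lies in one particular row or one particular column, hence
for at most `2 * rMax R` pairs. Summed over `p`, the comparison costs `16 q² * rMax R` and the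
unperturbed run contributes `2 * rMax R`; the resulting factor `2 + 16 q²` is below the claimed one.

Tightness: for a cyclic relation all rows and columns have size `r`, so the number `K` of solutions
has mean `r` and second moment at most `3 r²`. Grover search succeeds with probability `sin² (m θ)`,
where `m = 2 t + 1` and `sin² θ = K / N`. As `K` is random and unknown to the algorithm, `t` is
chosen small enough that `sin² (m θ) ≥ m² K / N - 4 (m² K / N)²` can be averaged using only these
two moments. If `r / N > 1 / 24`, a uniform guess suffices. -/

namespace PermSearch

/-- The Euclidean norm of a vector of amplitudes. -/
noncomputable def l2norm {ι : Type*} [Fintype ι] (v : ι → ℂ) : ℝ := ‖WithLp.toLp 2 v‖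

/-! ### Euclidean norms of amplitude vectors -/

section l2norm

variable {ι : Type*} [Fintype ι]

lemma l2norm_nonneg (v : ι → ℂ) : 0 ≤ l2norm v := norm_nonneg _

lemma l2norm_sq (v : ι → ℂ) : l2norm v ^ 2 = ∑ i, ‖v i‖ ^ 2 := by
  simp [l2norm, EuclideanSpace.norm_sq_eq]

lemma l2norm_add_le (v w : ι → ℂ) : l2norm (v + w) ≤ l2norm v + l2norm w := by
  simpa [l2norm] using norm_add_le (WithLp.toLp 2 v) (WithLp.toLp 2 w)

lemma l2norm_sub_le (v w : ι → ℂ) : l2norm (v - w) ≤ l2norm v + l2norm w := by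
  simpa [l2norm] using norm_sub_le (WithLp.toLp 2 v) (WithLp.toLp 2 w)

@[simp] lemma l2norm_zero : l2norm (0 : ι → ℂ) = 0 := by
  simp [l2norm]

lemma ofReal_l2norm_sq (v : ι → ℂ) : ((l2norm v ^ 2 : ℝ) : ℂ) = star v ⬝ᵥ v := by
  rw [l2norm_sq, dotProduct]
  push_cast
  refine sum_congr rfl fun i _ => ?_
  rw [Pi.star_apply, Complex.star_def, Complex.conj_mul']

lemma l2norm_unitary_mulVec [DecidableEq ι] (U : Matrix.unitaryGroup ι ℂ) (v : ι → ℂ) :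
    l2norm (U.1.mulVec v) = l2norm v := by
  have h : ((l2norm (U.1.mulVec v) ^ 2 : ℝ) : ℂ) = ((l2norm v ^ 2 : ℝ) : ℂ) := by
    rw [ofReal_l2norm_sq, ofReal_l2norm_sq, Matrix.star_mulVec, Matrix.dotProduct_mulVec,
      Matrix.vecMul_vecMul, ← Matrix.star_eq_conjTranspose, Unitary.coe_star_mul_self,
      Matrix.vecMul_one]
  exact (pow_left_inj₀ (l2norm_nonneg _) (l2norm_nonneg _) two_ne_zero).1 (by exact_mod_cast h)

end l2norm

/-! ### Query unitaries and the hybrid argument -/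

section oracle

variable {N : ℕ} {Y W : Type} [AddCommGroup Y]

/-- The action of a query on basis labels is a bijection. -/
def queryEquiv (enc : Fin N ↪ Y) (π : Equiv.Perm (Fin N)) : Label N Y W ≃ Label N Y W where
  toFun := queryLabel enc π
  invFun
    | (false, x, y, w) => (false, x, y - enc (π x), w)
    | (true, x, y, w) => (true, x, y - enc (π.symm x), w)
  left_inv := by rintro ⟨_ | _, x, y, w⟩ <;> simp [queryLabel]
  right_inv := by rintro ⟨_ | _, x, y, w⟩ <;> simp [queryLabel]

@[simp] lemma queryEquiv_apply (enc : Fin N ↪ Y) (π : Equiv.Perm (Fin N)) (j : Label N Y W) :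
    queryEquiv enc π j = queryLabel enc π j := rfl

variable [Fintype Y] [DecidableEq Y] [Fintype W] [DecidableEq W]

lemma oracle_mulVec (enc : Fin N ↪ Y) (π : Equiv.Perm (Fin N)) (v : Label N Y W → ℂ) :
    (oracle enc π).mulVec v = v ∘ (queryEquiv enc π).symm := by
  ext i
  simp only [Matrix.mulVec, dotProduct, oracle, Matrix.of_apply, Function.comp_apply, ite_mul,
    one_mul, zero_mul]
  rw [sum_eq_single ((queryEquiv enc π).symm i)]
  · rw [if_pos]
    exact ((queryEquiv enc π).apply_symm_apply i).symm
  · intro j _ hj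
    rw [if_neg]
    rintro rfl
    exact hj ((queryEquiv enc π).symm_apply_apply j).symm
  · simp

lemma l2norm_oracle_mulVec (enc : Fin N ↪ Y) (π : Equiv.Perm (Fin N)) (v : Label N Y W → ℂ) :
    l2norm ((oracle enc π).mulVec v) = l2norm v := by
  refine (pow_left_inj₀ (l2norm_nonneg _) (l2norm_nonneg _) two_ne_zero).1 ?_
  rw [oracle_mulVec, l2norm_sq, l2norm_sq]
  exact (queryEquiv enc π).symm.sum_comp fun i => ‖v i‖ ^ 2

/-- The part of a vector on the labels at which the oracles of `π` and `σ` differ. -/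
def differPart (enc : Fin N ↪ Y) (π σ : Equiv.Perm (Fin N)) (v : Label N Y W → ℂ) :
    Label N Y W → ℂ :=
  fun j => if queryLabel enc π j = queryLabel enc σ j then 0 else v j

/-- The two oracles agree on the complement of `differPart`, so only that part survives in the
difference, and each isometry contributes its norm once. -/
lemma l2norm_oracle_sub_oracle_le (enc : Fin N ↪ Y) (π σ : Equiv.Perm (Fin N))
    (v : Label N Y W → ℂ) :
    l2norm ((oracle enc π).mulVec v - (oracle enc σ).mulVec v) ≤
      2 * l2norm (differPart enc π σ v) := by
  have key : (oracle enc π).mulVec v - (oracle enc σ).mulVec v =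
      (oracle enc π).mulVec (differPart enc π σ v) -
        (oracle enc σ).mulVec (differPart enc π σ v) := by
    have h : (oracle enc π).mulVec (v - differPart enc π σ v) =
        (oracle enc σ).mulVec (v - differPart enc π σ v) := by
      ext i
      simp only [Matrix.mulVec, dotProduct, oracle, Matrix.of_apply]
      refine sum_congr rfl fun j _ => ?_
      by_cases hj : queryLabel enc π j = queryLabel enc σ j
      · rw [hj]
      · simp [differPart, hj]
    rw [Matrix.mulVec_sub, Matrix.mulVec_sub] at h
    linear_combination h
  rw [key]
  refine (l2norm_sub_le _ _).trans_eq ?_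
  rw [l2norm_oracle_mulVec, l2norm_oracle_mulVec, two_mul]

end oracle

namespace QueryAlgorithm

variable {N : ℕ} {Y : Type} [AddCommGroup Y] [Fintype Y] [DecidableEq Y] {q : ℕ}

lemma state_zero (A : QueryAlgorithm N Y q) (enc : Fin N ↪ Y) (π : Equiv.Perm (Fin N)) :
    A.state enc π 0 = (A.unitaryOp 0).1.mulVec (Pi.single A.start 1) := rfl

lemma state_succ (A : QueryAlgorithm N Y q) (enc : Fin N ↪ Y) (π : Equiv.Perm (Fin N))
    (i : Fin q) :
    A.state enc π i.succ =
      (A.unitaryOp i.succ).1.mulVec ((oracle enc π).mulVec (A.state enc π i.castSucc)) :=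
  Fin.induction_succ ..

lemma l2norm_state (A : QueryAlgorithm N Y q) (enc : Fin N ↪ Y) (π : Equiv.Perm (Fin N))
    (k : Fin (q + 1)) : l2norm (A.state enc π k) = 1 := by
  induction k using Fin.induction with
  | zero =>
    rw [state_zero, l2norm_unitary_mulVec]
    simp [l2norm]
  | succ i ih => rw [state_succ, l2norm_unitary_mulVec, l2norm_oracle_mulVec, ih]

/-- The hybrid argument: the final states for two oracles differ by at most twice the sum of the
norms of the parts of the queries at which the oracles differ. -/
lemma l2norm_state_sub_state_le (A : QueryAlgorithm N Y q) (enc : Fin N ↪ Y)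
    (π σ : Equiv.Perm (Fin N)) :
    l2norm (A.state enc π (Fin.last q) - A.state enc σ (Fin.last q)) ≤
      2 * ∑ i : Fin q, l2norm (differPart enc π σ (A.state enc σ i.castSucc)) := by
  have main (k : Fin (q + 1)) : l2norm (A.state enc π k - A.state enc σ k) ≤
      2 * ∑ i : Fin q, if i.castSucc < k then
        l2norm (differPart enc π σ (A.state enc σ i.castSucc)) else 0 := by
    induction k using Fin.induction with
    | zero => simp [state_zero]
    | succ k ih =>
      have step : l2norm (A.state enc π k.succ - A.state enc σ k.succ) ≤
          l2norm (A.state enc π k.castSucc - A.state enc σ k.castSucc) +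
            2 * l2norm (differPart enc π σ (A.state enc σ k.castSucc)) := by
        -- Inserting the oracle of `π` applied to the state of `σ` propagates the old error
        -- isometrically and confines the new error to the state of `σ`.
        rw [state_succ, state_succ, ← Matrix.mulVec_sub, l2norm_unitary_mulVec,
          ← sub_add_sub_cancel _ ((oracle enc π).mulVec (A.state enc σ k.castSucc)),
          ← Matrix.mulVec_sub]
        refine (l2norm_add_le _ _).trans (add_le_add ?_ (l2norm_oracle_sub_oracle_le ..))
        rw [l2norm_oracle_mulVec]
      have split : (∑ i : Fin q, if i.castSucc < k.succ then
          l2norm (differPart enc π σ (A.state enc σ i.castSucc)) else 0) =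
          (∑ i : Fin q, if i.castSucc < k.castSucc then
            l2norm (differPart enc π σ (A.state enc σ i.castSucc)) else 0) +
            l2norm (differPart enc π σ (A.state enc σ k.castSucc)) := by
        have hk : l2norm (differPart enc π σ (A.state enc σ k.castSucc)) = ∑ i : Fin q,
            if i = k then l2norm (differPart enc π σ (A.state enc σ i.castSucc)) else 0 := by
          simp
        rw [hk, ← sum_add_distrib]
        refine sum_congr rfl fun i _ => ?_
        simp only [Fin.castSucc_lt_succ_iff, Fin.castSucc_lt_castSucc_iff]
        rcases lt_trichotomy i k with h | rfl | h
        · simp [h, h.le, h.ne]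
        · simp
        · simp [h.not_ge, h.not_gt, h.ne']
      linarith
  simpa [Fin.castSucc_lt_last] using main (Fin.last q)

/-- Squaring `‖a‖ ≤ ‖b‖ + ‖a - b‖` gives the two factors 2. Cauchy–Schwarz over the `q` queries
turns the squared hybrid bound into `4 q` times a sum of squares. Only the run on `σ` appears on the
right, so the bound can be summed over many `π` for a fixed `σ`. -/
lemma outputProb_le (A : QueryAlgorithm N Y q) (enc : Fin N ↪ Y) (π σ : Equiv.Perm (Fin N))
    (x : Fin N) :
    A.outputProb enc π x ≤ 2 * A.outputProb enc σ x +
      8 * q * ∑ i : Fin q, l2norm (differPart enc π σ (A.state enc σ i.castSucc)) ^ 2 := by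
  have h1 : A.outputProb enc π x ≤ 2 * A.outputProb enc σ x +
      2 * l2norm (A.state enc π (Fin.last q) - A.state enc σ (Fin.last q)) ^ 2 := by
    have h : ∀ s, ‖A.state enc π (Fin.last q) s‖ ^ 2 ≤ 2 * ‖A.state enc σ (Fin.last q) s‖ ^ 2 +
        2 * ‖(A.state enc π (Fin.last q) - A.state enc σ (Fin.last q)) s‖ ^ 2 := by
      intro s
      have := norm_le_norm_add_norm_sub (A.state enc σ (Fin.last q) s)
        (A.state enc π (Fin.last q) s)
      rw [norm_sub_rev] at this
      rw [Pi.sub_apply]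
      calc _ ≤ (‖A.state enc σ (Fin.last q) s‖ +
            ‖A.state enc π (Fin.last q) s - A.state enc σ (Fin.last q) s‖) ^ 2 := by gcongr
        _ ≤ _ := by
          nlinarith [sq_nonneg (‖A.state enc σ (Fin.last q) s‖ -
            ‖A.state enc π (Fin.last q) s - A.state enc σ (Fin.last q) s‖)]
    refine (sum_le_sum fun s _ => h s).trans ?_
    rw [sum_add_distrib, ← mul_sum, ← mul_sum, l2norm_sq]
    refine add_le_add le_rfl (mul_le_mul_of_nonneg_left ?_ zero_le_two)
    exact sum_le_sum_of_subset_of_nonneg (filter_subset _ _) fun _ _ _ => by positivity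
  have h2 : l2norm (A.state enc π (Fin.last q) - A.state enc σ (Fin.last q)) ^ 2 ≤
      4 * (q * ∑ i : Fin q, l2norm (differPart enc π σ (A.state enc σ i.castSucc)) ^ 2) := by
    have h3 := pow_le_pow_left₀ (l2norm_nonneg _) (A.l2norm_state_sub_state_le enc π σ) 2
    have h4 := sq_sum_le_card_mul_sum_sq (s := (univ : Finset (Fin q)))
      (f := fun i => l2norm (differPart enc π σ (A.state enc σ i.castSucc)))
    rw [card_univ, Fintype.card_fin] at h4
    linarith
  linarith

lemma sum_outputProb (A : QueryAlgorithm N Y q) (enc : Fin N ↪ Y) (π : Equiv.Perm (Fin N)) :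
    ∑ x, A.outputProb enc π x = 1 := by
  unfold outputProb
  rw [sum_fiberwise, ← l2norm_sq, l2norm_state, one_pow]

end QueryAlgorithm

/-! ### Redirected permutations and the upper bound -/

section counting

variable {N : ℕ}

lemma card_row_le_rMax (R : Finset (Fin N × Fin N)) (x : Fin N) : (row R x).card ≤ rMax R :=
  le_max_of_le_left (le_sup (f := fun x => (row R x).card) (mem_univ x))

lemma card_col_le_rMax (R : Finset (Fin N × Fin N)) (y : Fin N) : (col R y).card ≤ rMax R :=
  le_max_of_le_right (le_sup (f := fun y => (col R y).card) (mem_univ y))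

lemma card_filter_fst (R : Finset (Fin N × Fin N)) (x : Fin N) :
    (R.filter fun p => p.1 = x).card = (row R x).card := by
  refine card_bij' (fun p _ => p.2) (fun y _ => (x, y)) ?_ ?_ ?_ ?_ <;> simp +contextual [row]
  all_goals grind

lemma card_filter_snd (R : Finset (Fin N × Fin N)) (y : Fin N) :
    (R.filter fun p => p.2 = y).card = (col R y).card := by
  refine card_bij' (fun p _ => p.1) (fun x _ => (x, y)) ?_ ?_ ?_ ?_ <;> simp +contextual [col]
  all_goals grind

/-- The permutation `σ` changed at two places so that it sends `p.1` to `p.2`. -/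
def redirect (p : Fin N × Fin N) (σ : Equiv.Perm (Fin N)) : Equiv.Perm (Fin N) :=
  Equiv.swap p.2 (σ p.1) * σ

/-- Redirecting a uniformly random permutation gives a uniformly random permutation among those
that send `p.1` to `p.2`. -/
lemma sum_redirect (p : Fin N × Fin N) (f : Equiv.Perm (Fin N) → ℝ) :
    ∑ σ, f (redirect p σ) = N * ∑ π ∈ univ.filter (fun π => π p.1 = p.2), f π := by
  rw [← sum_fiberwise univ (fun σ : Equiv.Perm (Fin N) => σ p.1)]
  -- On the fibre `σ p.1 = z` redirection is left multiplication by a fixed transposition, a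
  -- bijection onto the target set; the `N` values of `z` give the factor `N`.
  have h (z : Fin N) : ∑ σ ∈ univ.filter (fun σ : Equiv.Perm (Fin N) => σ p.1 = z),
      f (redirect p σ) = ∑ π ∈ univ.filter (fun π => π p.1 = p.2), f π := by
    refine sum_bij' (fun σ _ => Equiv.swap p.2 z * σ) (fun σ _ => Equiv.swap p.2 z * σ)
      ?_ ?_ ?_ ?_ ?_ <;> simp +contextual [redirect]
  simp [h]

/-- Redirection changes `σ` only at `p.1` and at the preimage of `p.2`. A forward query at `z`
notices only if `p.1 = z` or `p.2 = σ z`, an inverse query only if `p.1 = σ.symm z` or `p.2 = z`: in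
both cases one row and one column of `R`. -/
lemma card_filter_redirect_ne_le {Y W : Type} [AddCommGroup Y] [DecidableEq Y] [DecidableEq W]
    (enc : Fin N ↪ Y) (R : Finset (Fin N × Fin N)) (σ : Equiv.Perm (Fin N)) (j : Label N Y W) :
    (R.filter fun p => queryLabel enc (redirect p σ) j ≠ queryLabel enc σ j).card ≤
      2 * rMax R := by
  have main (x y : Fin N) (h : ∀ p ∈ R, queryLabel enc (redirect p σ) j ≠ queryLabel enc σ j →
      p.1 = x ∨ p.2 = y) :
      (R.filter fun p => queryLabel enc (redirect p σ) j ≠ queryLabel enc σ j).card ≤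
        2 * rMax R := by
    calc _ ≤ ((R.filter fun p => p.1 = x) ∪ (R.filter fun p => p.2 = y)).card := by
          refine card_le_card fun p hp => ?_
          rw [mem_filter] at hp
          have := h p hp.1 hp.2
          simp only [mem_union, mem_filter]
          tauto
      _ ≤ _ := by
          refine (card_union_le _ _).trans ?_
          rw [card_filter_fst, card_filter_snd, two_mul]
          exact add_le_add (card_row_le_rMax R x) (card_col_le_rMax R y)
  rcases j with ⟨_ | _, z, y, w⟩
  · refine main z (σ z) fun p _ hp => ?_
    by_contra hc
    push Not at hc
    refine hp ?_
    have : redirect p σ z = σ z := by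
      rw [redirect, Equiv.Perm.mul_apply, Equiv.swap_apply_of_ne_of_ne hc.2.symm]
      exact fun h => hc.1 (σ.injective h).symm
    simp [queryLabel, this]
  · refine main (σ.symm z) z fun p _ hp => ?_
    by_contra hc
    push Not at hc
    refine hp ?_
    have : (redirect p σ).symm z = σ.symm z := by
      rw [Equiv.symm_apply_eq, redirect, Equiv.Perm.mul_apply, Equiv.apply_symm_apply,
        Equiv.swap_apply_of_ne_of_ne hc.2.symm]
      rintro rfl
      simp at hc
    simp [queryLabel, this]

end counting

namespace QueryAlgorithm

variable {N : ℕ} {Y : Type} [AddCommGroup Y] [Fintype Y] [DecidableEq Y] {q : ℕ}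

/-- Exchanging the sums weights each `‖v j‖ ^ 2` by the number of pairs whose redirection is visible
at `j`. -/
lemma sum_differPart_redirect_le {W : Type} [Fintype W] [DecidableEq W]
    (enc : Fin N ↪ Y) (R : Finset (Fin N × Fin N)) (σ : Equiv.Perm (Fin N))
    (v : Label N Y W → ℂ) :
    ∑ p ∈ R, l2norm (differPart enc (redirect p σ) σ v) ^ 2 ≤ 2 * rMax R * l2norm v ^ 2 := by
  simp only [l2norm_sq]
  rw [sum_comm, mul_sum]
  refine sum_le_sum fun j _ => ?_
  have h : ∀ p ∈ R, ‖differPart enc (redirect p σ) σ v j‖ ^ 2 =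
      if queryLabel enc (redirect p σ) j ≠ queryLabel enc σ j then ‖v j‖ ^ 2 else 0 := by
    intro p _
    by_cases hp : queryLabel enc (redirect p σ) j = queryLabel enc σ j <;> simp [differPart, hp]
  rw [sum_congr rfl h, ← sum_filter, sum_const, nsmul_eq_mul]
  gcongr
  exact_mod_cast card_filter_redirect_ne_le enc R σ j

lemma sum_outputProb_fst_le (A : QueryAlgorithm N Y q) (enc : Fin N ↪ Y)
    (R : Finset (Fin N × Fin N)) (σ : Equiv.Perm (Fin N)) :
    ∑ p ∈ R, A.outputProb enc σ p.1 ≤ rMax R := by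
  have h0 (x : Fin N) : 0 ≤ A.outputProb enc σ x := sum_nonneg fun _ _ => by positivity
  rw [← sum_fiberwise R (fun p => p.1)]
  calc _ = ∑ x, (row R x).card * A.outputProb enc σ x := by
        refine sum_congr rfl fun x _ => ?_
        rw [← card_filter_fst, ← nsmul_eq_mul, ← sum_const]
        exact sum_congr rfl fun p hp => by rw [(mem_filter.1 hp).2]
    _ ≤ ∑ x, rMax R * A.outputProb enc σ x :=
        sum_le_sum fun x _ => mul_le_mul_of_nonneg_right
          (by exact_mod_cast card_row_le_rMax R x) (h0 x)
    _ = _ := by rw [← mul_sum, sum_outputProb, mul_one]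

lemma sum_outputProb_redirect_le (A : QueryAlgorithm N Y q) (enc : Fin N ↪ Y)
    (R : Finset (Fin N × Fin N)) (σ : Equiv.Perm (Fin N)) :
    ∑ p ∈ R, A.outputProb enc (redirect p σ) p.1 ≤ (2 + 16 * (q : ℝ) ^ 2) * rMax R := by
  refine (sum_le_sum fun p _ => A.outputProb_le enc (redirect p σ) σ p.1).trans ?_
  rw [sum_add_distrib, ← mul_sum, ← mul_sum, sum_comm]
  have h1 := A.sum_outputProb_fst_le enc R σ
  have h2 : ∑ i : Fin q, ∑ p ∈ R,
      l2norm (differPart enc (redirect p σ) σ (A.state enc σ i.castSucc)) ^ 2 ≤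
      q * (2 * rMax R) := by
    refine (sum_le_card_nsmul univ _ (2 * rMax R : ℝ) fun i _ => ?_).trans_eq (by simp)
    simpa [l2norm_state] using sum_differPart_redirect_le enc R σ (A.state enc σ i.castSucc)
  have h3 := mul_le_mul_of_nonneg_left h2 (by positivity : (0 : ℝ) ≤ 8 * q)
  linarith

lemma successProb_le_of_pos (A : QueryAlgorithm N Y q) (enc : Fin N ↪ Y) (hN : 0 < N)
    (R : Finset (Fin N × Fin N)) :
    A.successProb enc R ≤ (2 + 16 * (q : ℝ) ^ 2) * rMax R / N := by
  have hN' : (0 : ℝ) < N := by exact_mod_cast hN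
  have hcard : (0 : ℝ) < Fintype.card (Equiv.Perm (Fin N)) := by exact_mod_cast Fintype.card_pos
  rw [successProb, div_le_div_iff₀ hcard hN']
  -- For fixed `π`, the solutions `x` correspond to the pairs `p ∈ R` with `π p.1 = p.2`.
  have key : (∑ π : Equiv.Perm (Fin N), ∑ x ∈ univ.filter (fun x => (x, π x) ∈ R),
      A.outputProb enc π x) * N =
      ∑ σ : Equiv.Perm (Fin N), ∑ p ∈ R, A.outputProb enc (redirect p σ) p.1 := by
    rw [sum_comm]
    simp_rw [fun p : Fin N × Fin N => sum_redirect p fun π => A.outputProb enc π p.1]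
    rw [← mul_sum, mul_comm]
    congr 1
    simp_rw [sum_filter]
    rw [sum_comm (s := R)]
    refine sum_congr rfl fun π _ => ?_
    rw [← sum_filter, ← sum_filter]
    refine sum_bij' (fun x _ => (x, π x)) (fun p _ => p.1) ?_ ?_ ?_ ?_ ?_ <;> simp +contextual
  rw [key]
  refine (sum_le_card_nsmul univ _ _ fun σ _ => A.sum_outputProb_redirect_le enc R σ).trans_eq ?_
  rw [card_univ, nsmul_eq_mul, mul_comm]

end QueryAlgorithm

/-! ### Moments of the number of solutions -/

section counting

variable {N : ℕ}

/-- The solutions of the search problem given by `R` for the permutation `π`. -/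
def solutions (R : Finset (Fin N × Fin N)) (π : Equiv.Perm (Fin N)) : Finset (Fin N) :=
  univ.filter fun x => (x, π x) ∈ R

lemma card_solutions (R : Finset (Fin N × Fin N)) (π : Equiv.Perm (Fin N)) :
    ((solutions R π).card : ℝ) = ∑ p ∈ R, if π p.1 = p.2 then 1 else 0 := by
  rw [sum_boole]
  congr 1
  refine card_bij' (fun x _ => (x, π x)) (fun p _ => p.1) ?_ ?_ ?_ ?_ <;>
    simp +contextual [solutions]

lemma sum_perm_apply_eq (p : Fin N × Fin N) :
    N * ∑ π : Equiv.Perm (Fin N), (if π p.1 = p.2 then (1 : ℝ) else 0) =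
      Fintype.card (Equiv.Perm (Fin N)) := by
  rw [← sum_filter, ← sum_redirect p fun _ => 1]
  simp

/-- Two pairs sharing only one coordinate exclude each other. In general, after redirection along
`p` the second event requires `σ p'.1 = p'.2` or `σ p.1 = p'.2`, each of probability `1 / N`; the
union bound gives the factor 2. -/
lemma sum_perm_apply_eq_and_le {p p' : Fin N × Fin N} (hp : p ≠ p') :
    (N : ℝ) ^ 2 * ∑ π : Equiv.Perm (Fin N),
      ((if π p.1 = p.2 then (1 : ℝ) else 0) * if π p'.1 = p'.2 then 1 else 0) ≤
      2 * Fintype.card (Equiv.Perm (Fin N)) := by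
  by_cases h1 : p.1 = p'.1
  · have h2 : p.2 ≠ p'.2 := fun h => hp (Prod.ext h1 h)
    rw [sum_eq_zero]
    · simp
    · intro π _
      rw [h1]
      by_cases h : π p'.1 = p.2
      · rw [if_neg (h ▸ h2 : π p'.1 ≠ p'.2), mul_zero]
      · rw [if_neg h, zero_mul]
  have hs : ∑ π : Equiv.Perm (Fin N),
      ((if π p.1 = p.2 then (1 : ℝ) else 0) * if π p'.1 = p'.2 then 1 else 0) =
      ∑ π ∈ univ.filter (fun π : Equiv.Perm (Fin N) => π p.1 = p.2),
        if π p'.1 = p'.2 then 1 else 0 := by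
    rw [sum_filter]
    exact sum_congr rfl fun π _ => by split_ifs <;> simp
  rw [sq, hs, mul_assoc, ← sum_redirect p fun π => if π p'.1 = p'.2 then 1 else 0]
  have hle : ∑ σ : Equiv.Perm (Fin N), (if redirect p σ p'.1 = p'.2 then (1 : ℝ) else 0) ≤
      ∑ σ : Equiv.Perm (Fin N), ((if σ p'.1 = p'.2 then (1 : ℝ) else 0) +
        if σ p.1 = p'.2 then 1 else 0) := by
    refine sum_le_sum fun σ _ => ?_
    by_cases h : redirect p σ p'.1 = p'.2
    · have : σ p'.1 = p'.2 ∨ σ p.1 = p'.2 := by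
        rw [redirect, Equiv.Perm.mul_apply] at h
        by_cases h2 : σ p'.1 = p.2
        · rw [h2, Equiv.swap_apply_left] at h
          exact Or.inr h
        · rw [Equiv.swap_apply_of_ne_of_ne h2 fun h3 => h1 (σ.injective h3).symm] at h
          exact Or.inl h
      rcases this with h' | h' <;> rw [if_pos h, if_pos h'] <;> split_ifs <;> norm_num
    · rw [if_neg h]
      positivity
  refine (mul_le_mul_of_nonneg_left hle (Nat.cast_nonneg N)).trans_eq ?_
  rw [sum_add_distrib, mul_add, sum_perm_apply_eq p', sum_perm_apply_eq (p.1, p'.2), two_mul]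

lemma sum_card_solutions (R : Finset (Fin N × Fin N)) :
    N * ∑ π, ((solutions R π).card : ℝ) = R.card * Fintype.card (Equiv.Perm (Fin N)) := by
  simp_rw [card_solutions]
  rw [sum_comm, mul_sum, sum_congr rfl fun p _ => sum_perm_apply_eq p]
  simp

/-- Expanding the square into pairs, the diagonal gives `R.card * N` and the pair bound gives `2 *
R.card ^ 2`. -/
lemma sum_card_solutions_sq_le (R : Finset (Fin N × Fin N)) :
    (N : ℝ) ^ 2 * ∑ π, ((solutions R π).card : ℝ) ^ 2 ≤
      (R.card * N + 2 * R.card ^ 2) * Fintype.card (Equiv.Perm (Fin N)) := by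
  simp_rw [card_solutions, sq (∑ p ∈ R, _), sum_mul_sum]
  rw [sum_comm, mul_sum]
  have h (p) (hp : p ∈ R) : (N : ℝ) ^ 2 * ∑ π : Equiv.Perm (Fin N), ∑ p' ∈ R,
      ((if π p.1 = p.2 then (1 : ℝ) else 0) * if π p'.1 = p'.2 then 1 else 0) ≤
      (N + 2 * R.card) * Fintype.card (Equiv.Perm (Fin N)) := by
    rw [sum_comm, mul_sum]
    have h' (p') (_ : p' ∈ R) : (N : ℝ) ^ 2 * ∑ π : Equiv.Perm (Fin N),
        ((if π p.1 = p.2 then (1 : ℝ) else 0) * if π p'.1 = p'.2 then 1 else 0) ≤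
        (if p = p' then (N * Fintype.card (Equiv.Perm (Fin N)) : ℝ) else 0) +
          2 * Fintype.card (Equiv.Perm (Fin N)) := by
      by_cases hpp : p = p'
      · subst hpp
        rw [if_pos rfl, ← sum_perm_apply_eq p, ← mul_assoc, ← sq]
        simp only [mul_ite, mul_one, mul_zero, ← ite_and, and_self]
        have : 0 ≤ ∑ π : Equiv.Perm (Fin N), (if π p.1 = p.2 then (1 : ℝ) else 0) :=
          sum_nonneg fun _ _ => by positivity
        have : (0 : ℝ) ≤ 2 * (N * ∑ π : Equiv.Perm (Fin N), if π p.1 = p.2 then (1 : ℝ) else 0) :=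
          by positivity
        linarith
      · rw [if_neg hpp, zero_add]
        exact sum_perm_apply_eq_and_le hpp
    refine (sum_le_sum h').trans_eq ?_
    rw [sum_add_distrib, sum_ite_eq, if_pos hp, sum_const, nsmul_eq_mul]
    ring
  refine (sum_le_sum h).trans_eq ?_
  rw [sum_const, nsmul_eq_mul]
  ring

/-- The relation of all `(x, y)` for which `y - x` is one of the first `r` residues. -/
def cyclicRel (N r : ℕ) [NeZero N] : Finset (Fin N × Fin N) :=
  univ.filter fun p => (p.2 - p.1).val < r

variable [NeZero N] {r : ℕ}

lemma card_row_cyclicRel (hr : r ≤ N) (x : Fin N) : (row (cyclicRel N r) x).card = r := by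
  have h : (row (cyclicRel N r) x).map (Equiv.subRight x).toEmbedding =
      univ.filter fun z : Fin N => z.val < r := by
    ext z
    simp [row, cyclicRel]
  rw [← card_map, h, Fin.card_filter_val_lt, min_eq_right hr]

lemma card_col_cyclicRel (hr : r ≤ N) (y : Fin N) : (col (cyclicRel N r) y).card = r := by
  have h : (col (cyclicRel N r) y).map (Equiv.subLeft y).toEmbedding =
      univ.filter fun z : Fin N => z.val < r := by
    ext z
    simp [col, cyclicRel]
  rw [← card_map, h, Fin.card_filter_val_lt, min_eq_right hr]

lemma rMax_cyclicRel (hr : r ≤ N) : rMax (cyclicRel N r) = r := by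
  simp [rMax, card_row_cyclicRel hr, card_col_cyclicRel hr, sup_const univ_nonempty]

lemma card_cyclicRel (hr : r ≤ N) : (cyclicRel N r).card = N * r := by
  rw [card_eq_sum_card_fiberwise (f := Prod.fst) (t := univ) (by simp)]
  simp [card_filter_fst, card_row_cyclicRel hr]

end counting

/-- The success probability of amplitude amplification, in terms of its leading term. -/
lemma le_sin_sq_mul_arcsin_sqrt {k m : ℝ} (hk0 : 0 ≤ k) (hk1 : k ≤ 1) (hm : 0 ≤ m) :
    m ^ 2 * k - 4 * (m ^ 2 * k) ^ 2 ≤ Real.sin (m * Real.arcsin (√k)) ^ 2 := by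
  by_cases hu : 1 / 4 ≤ m ^ 2 * k
  -- Here the left side is at most 0.
  · nlinarith [sq_nonneg (Real.sin (m * Real.arcsin (√k)))]
  push Not at hu
  have hs0 := Real.sqrt_nonneg k
  have hs1 : √k ≤ 1 := Real.sqrt_le_one.2 hk1
  have hsin : Real.sin (Real.arcsin (√k)) = √k := Real.sin_arcsin (by linarith) hs1
  have h0 : 0 ≤ Real.arcsin (√k) := Real.arcsin_nonneg.2 hs0
  have hle : √k ≤ Real.arcsin (√k) := by
    conv_lhs => rw [← hsin]
    exact Real.sin_le h0
  have hge : Real.arcsin (√k) ≤ Real.pi / 2 * √k := by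
    have := Real.mul_le_sin h0 (Real.arcsin_le_pi_div_two _)
    rw [hsin, div_mul_eq_mul_div, div_le_iff₀ Real.pi_pos] at this
    linarith
  set w := m * √k with hw
  have hw0 : 0 ≤ w := by positivity
  have hwsq : w ^ 2 = m ^ 2 * k := by rw [hw, mul_pow, Real.sq_sqrt hk0]
  have hw1 : w ≤ 1 / 2 := by nlinarith
  have h1 : w - w ^ 3 / 6 ≤ Real.sin w := by
    rcases hw0.eq_or_lt with h | h
    · simp [← h]
    · exact (Real.sin_gt_sub_cube h).le
  have h2 : Real.sin w ≤ Real.sin (m * Real.arcsin (√k)) := by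
    refine Real.sin_le_sin_of_le_of_le_pi_div_two (by linarith [Real.pi_pos]) ?_
      (mul_le_mul_of_nonneg_left hle hm)
    calc m * Real.arcsin (√k) ≤ m * (Real.pi / 2 * √k) := by gcongr
      _ = Real.pi / 2 * w := by ring
      _ ≤ Real.pi / 2 * 1 := by gcongr; linarith
      _ = _ := mul_one _
  have h3 : 0 ≤ w - w ^ 3 / 6 := by nlinarith [mul_nonneg hw0 hw0]
  calc _ = w ^ 2 - 4 * (w ^ 2) ^ 2 := by rw [hwsq]
    -- The square is `w² - w⁴ / 3 + w⁶ / 36`, so the constant 4 leaves room.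
    _ ≤ (w - w ^ 3 / 6) ^ 2 := by
      have : 0 ≤ w ^ 4 := by positivity
      have : 0 ≤ w ^ 6 := by positivity
      nlinarith
    _ ≤ _ := pow_le_pow_left₀ h3 (h1.trans h2) 2

/-! ### Reflections and monomial unitaries -/

section gates

variable {ι : Type*} [Fintype ι] [DecidableEq ι]

/-- The reflection `1 - c v vᴴ`, for a vector with `c ‖v‖² = 2`. -/
noncomputable def reflection (c : ℝ) (v : ι → ℂ) (h : c * (star v ⬝ᵥ v) = 2) :
    Matrix.unitaryGroup ι ℂ :=
  ⟨1 - (c : ℂ) • Matrix.vecMulVec v (star v), by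
    have hstar : star (1 - (c : ℂ) • Matrix.vecMulVec v (star v)) =
        1 - (c : ℂ) • Matrix.vecMulVec v (star v) := by
      rw [star_sub, star_one, star_smul, Matrix.star_eq_conjTranspose,
        Matrix.conjTranspose_vecMulVec, star_star, Complex.star_def, Complex.conj_ofReal]
    rw [Matrix.mem_unitaryGroup_iff, hstar, sub_mul, one_mul, mul_sub, mul_one,
      smul_mul_smul_comm, Matrix.vecMulVec_mul_vecMulVec, Matrix.vecMulVec_smul, smul_smul,
      mul_assoc, h, mul_two, add_smul]
    abel⟩

lemma reflection_mulVec (c : ℝ) (v : ι → ℂ) (h : c * (star v ⬝ᵥ v) = 2) (f : ι → ℂ) :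
    (reflection c v h).1.mulVec f = f - (c * (star v ⬝ᵥ f)) • v := by
  simp [reflection, Matrix.sub_mulVec, Matrix.smul_mulVec, Matrix.vecMulVec_mulVec, mul_smul]

/-- There is a unitary matrix that sends `e` to `s`, if these are distinct unit vectors whose inner
product is real. -/
lemma exists_unitary_mulVec_eq {e s : ι → ℂ} {ρ : ℝ} (he : star e ⬝ᵥ e = 1)
    (hs : star s ⬝ᵥ s = 1) (hes : star e ⬝ᵥ s = ρ) (hse : star s ⬝ᵥ e = ρ) (hρ : ρ ≠ 1) :
    ∃ U : Matrix.unitaryGroup ι ℂ, U.1.mulVec e = s := by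
  have hρ' : (1 : ℂ) - ρ ≠ 0 := by
    rw [sub_ne_zero]
    exact_mod_cast hρ.symm
  -- Householder reflection along `e - s`: since the inner product is real, `‖e - s‖² = 2 - 2ρ`,
  -- which fixes the coefficient.
  have h : ((1 - ρ)⁻¹ : ℝ) * (star (e - s) ⬝ᵥ (e - s)) = 2 := by
    rw [star_sub, sub_dotProduct, dotProduct_sub, dotProduct_sub, he, hs, hes, hse]
    push_cast
    field_simp
    ring
  refine ⟨reflection _ _ h, ?_⟩
  rw [reflection_mulVec, star_sub, sub_dotProduct, he, hse]
  push_cast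
  rw [inv_mul_cancel₀ hρ', one_smul, sub_sub_cancel]

/-- The unitary that sends the basis vector `j` to `c j` times the basis vector `e j`. -/
def monomialGate (e : Equiv.Perm ι) (c : ι → ℂ) (hc : ∀ j, star (c j) * c j = 1) :
    Matrix.unitaryGroup ι ℂ :=
  ⟨Matrix.of fun i j => if i = e j then c j else 0, by
    rw [Matrix.mem_unitaryGroup_iff']
    ext i j
    rw [Matrix.mul_apply, sum_eq_single (e i)]
    · rcases eq_or_ne i j with rfl | h
      · simpa using hc i
      · simp [h]
    · intro k _ hk
      simp [hk]
    · simp⟩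

lemma monomialGate_mulVec_apply (e : Equiv.Perm ι) (c : ι → ℂ) (hc : ∀ j, star (c j) * c j = 1)
    (f : ι → ℂ) (j : ι) : (monomialGate e c hc).1.mulVec f (e j) = c j * f j := by
  simp [monomialGate, Matrix.mulVec, dotProduct]

end gates

/-! ### The gates and the rotation of Grover's algorithm -/

section grover

variable {N : ℕ} {Y : Type}

open Classical in
/-- The sign `1` at labels whose answer register holds a value related to the query register,
and `-1` at all others. -/
noncomputable def relSign (enc : Fin N ↪ Y) (R : Finset (Fin N × Fin N)) (j : Label N Y Unit) : ℂ :=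
  if ∃ z, enc z = j.2.2.1 ∧ (j.2.1, z) ∈ R then 1 else -1

lemma relSign_enc (enc : Fin N ↪ Y) (R : Finset (Fin N × Fin N)) (b : Bool) (x z : Fin N)
    (w : Unit) : relSign enc R (b, x, enc z, w) = if (x, z) ∈ R then 1 else -1 := by
  simp [relSign]

variable [AddCommGroup Y]

lemma sum_queryState [Fintype Y] {M : Type*} [AddCommMonoid M] (F : Label N Y Unit → M)
    (h : ∀ j, ¬ (j.1 = false ∧ j.2.2.1 = 0) → F j = 0) :
    ∑ j, F j = ∑ x, F (false, x, 0, ()) := by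
  refine (sum_of_injOn (fun x => (false, x, 0, ())) ?_ (by simp) ?_ (by simp)).symm
  · intro x _ x' _ hx
    simpa using hx
  · rintro ⟨b, x, y, w⟩ _ hj
    refine h _ ?_
    rintro ⟨hb, hy⟩
    dsimp at hb hy
    subst hb hy
    exact hj ⟨x, by simp, rfl⟩

variable [DecidableEq Y]

/-- The state with amplitude `f x` at forward query `x` with answer register `0`. -/
def queryState (Y : Type) [AddCommGroup Y] [DecidableEq Y] (f : Fin N → ℂ) : Label N Y Unit → ℂ :=
  fun j => if j.1 = false ∧ j.2.2.1 = 0 then f j.2.1 else 0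

lemma star_queryState_dotProduct [Fintype Y] (f g : Fin N → ℂ) :
    star (queryState Y f) ⬝ᵥ queryState Y g = star f ⬝ᵥ g := by
  rw [dotProduct, sum_queryState]
  · simp [queryState, dotProduct]
  · intro j hj
    simp [queryState, hj]

/-- Negation of the answer register. -/
def negAnswer : Equiv.Perm (Label N Y Unit) where
  toFun j := (j.1, j.2.1, -j.2.2.1, j.2.2.2)
  invFun j := (j.1, j.2.1, -j.2.2.1, j.2.2.2)
  left_inv j := by simp
  right_inv j := by simp

variable [Fintype Y]

/-- The gate between the two queries of an iteration: it applies the sign and negates the answer,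
so that the second query erases it. -/
noncomputable def signGate (enc : Fin N ↪ Y) (R : Finset (Fin N × Fin N)) :
    Matrix.unitaryGroup (Label N Y Unit) ℂ :=
  monomialGate negAnswer (relSign enc R) fun j => by
    unfold relSign
    split_ifs <;> simp

/-- Compute, mark, uncompute: the first query writes `enc (π x)`, the gate negates it, and the
second query adds it back to 0. This works in any group `Y`, without addition being self-inverse.
The sign is the negative of the usual phase flip, which cancels against the sign of `diffusionGate`.
-/
lemma oracle_signGate_oracle_mulVec (enc : Fin N ↪ Y) (R : Finset (Fin N × Fin N))
    (π : Equiv.Perm (Fin N)) (f : Fin N → ℂ) :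
    (oracle enc π).mulVec ((signGate enc R).1.mulVec ((oracle enc π).mulVec (queryState Y f))) =
      queryState Y fun x => (if (x, π x) ∈ R then 1 else -1) * f x := by
  funext i
  obtain ⟨j, rfl⟩ := ((queryEquiv enc π).trans
    (negAnswer.trans (queryEquiv enc π))).surjective i
  rw [oracle_mulVec, oracle_mulVec]
  simp only [Equiv.trans_apply, Function.comp_apply, Equiv.symm_apply_apply]
  rw [signGate, monomialGate_mulVec_apply, Function.comp_apply, Equiv.symm_apply_apply]
  obtain ⟨_ | _, x, y, w⟩ := j
  · by_cases hy : y = 0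
    · subst hy
      simp [queryState, queryLabel, negAnswer, relSign_enc]
    · simp [queryState, queryLabel, negAnswer, hy]
  · simp [queryState, queryLabel, negAnswer]

/-- The amplitudes of the uniform superposition of all queries. -/
noncomputable def uniformAmp (N : ℕ) : Fin N → ℂ := fun _ => (((√N)⁻¹ : ℝ) : ℂ)

lemma star_uniformAmp_dotProduct (f : Fin N → ℂ) :
    star (uniformAmp N) ⬝ᵥ f = ((√N)⁻¹ : ℝ) * ∑ x, f x := by
  simp [uniformAmp, dotProduct, mul_sum]

lemma star_uniformAmp_dotProduct_self [NeZero N] :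
    star (uniformAmp N) ⬝ᵥ uniformAmp N = 1 := by
  have hN : (0 : ℝ) < N := by exact_mod_cast NeZero.pos N
  rw [star_uniformAmp_dotProduct]
  simp only [uniformAmp, sum_const, card_univ, Fintype.card_fin, nsmul_eq_mul]
  norm_cast
  have := Real.sq_sqrt hN.le
  have h0 : √(N : ℝ) ≠ 0 := (Real.sqrt_pos.2 hN).ne'
  field_simp
  linarith

/-- The reflection about the uniform superposition, up to sign. -/
noncomputable def diffusionGate (N : ℕ) [NeZero N] (Y : Type) [AddCommGroup Y] [DecidableEq Y]
    [Fintype Y] : Matrix.unitaryGroup (Label N Y Unit) ℂ :=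
  reflection 2 (queryState Y (uniformAmp N)) (by
    rw [star_queryState_dotProduct, star_uniformAmp_dotProduct_self]
    simp)

lemma diffusionGate_mulVec [NeZero N] (f : Fin N → ℂ) :
    (diffusionGate N Y).1.mulVec (queryState Y f) =
      queryState Y fun x => f x - 2 * ((N : ℂ)⁻¹ * ∑ x', f x') := by
  have hs : (((√(N : ℝ))⁻¹ : ℝ) : ℂ) * (((√(N : ℝ))⁻¹ : ℝ) : ℂ) = (N : ℂ)⁻¹ := by
    rw [← Complex.ofReal_mul, ← mul_inv, Real.mul_self_sqrt (Nat.cast_nonneg N)]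
    simp
  funext j
  rw [diffusionGate, reflection_mulVec, star_queryState_dotProduct, star_uniformAmp_dotProduct]
  by_cases hj : j.1 = false ∧ j.2.2.1 = 0
  · simp only [Pi.sub_apply, Pi.smul_apply, queryState, hj, and_self, if_true, smul_eq_mul,
      uniformAmp]
    rw [← hs]
    push_cast
    ring
  · simp [queryState, hj]

lemma exists_preparation (hN : 2 ≤ N) (x₀ : Fin N) :
    ∃ U : Matrix.unitaryGroup (Label N Y Unit) ℂ,
      U.1.mulVec (Pi.single (false, x₀, 0, ()) 1) = queryState Y (uniformAmp N) := by
  have : NeZero N := ⟨by omega⟩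
  have he : (Pi.single (false, x₀, 0, ()) 1 : Label N Y Unit → ℂ) =
      queryState Y (Pi.single x₀ 1) := by
    funext ⟨b, x, y, w⟩
    by_cases hb : b = false <;> by_cases hy : y = 0 <;> by_cases hx : x = x₀ <;>
      simp [queryState, hb, hy, hx]
  rw [he]
  refine exists_unitary_mulVec_eq (ρ := (√N)⁻¹) ?_ ?_ ?_ ?_ ?_
  · simp [star_queryState_dotProduct]
  · rw [star_queryState_dotProduct, star_uniformAmp_dotProduct_self]
  · simp [star_queryState_dotProduct, uniformAmp]
  · simp [star_queryState_dotProduct, uniformAmp]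
  -- The overlap of a basis state with the uniform state is `1 / √N`, which differs from 1 because
  -- `N ≥ 2`.
  · rw [ne_eq, inv_eq_one, Real.sqrt_eq_one]
    exact_mod_cast (by omega : N ≠ 1)

/-- The gates of Grover's algorithm with `t` iterations, after which the oracle is queried without
effect on the query register. -/
noncomputable def groverGate (hN : 2 ≤ N) (enc : Fin N ↪ Y) (R : Finset (Fin N × Fin N)) (t n : ℕ) :
    Matrix.unitaryGroup (Label N Y Unit) ℂ :=
  haveI : NeZero N := ⟨by omega⟩
  if n = 0 then (exists_preparation hN 0).choose
  else if 2 * t < n then 1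
  else if n % 2 = 1 then signGate enc R
  else diffusionGate N Y

/-- Grover's algorithm with `t` iterations among `q` queries. -/
noncomputable def grover (hN : 2 ≤ N) (enc : Fin N ↪ Y) (R : Finset (Fin N × Fin N)) (t q : ℕ) :
    QueryAlgorithm N Y q :=
  haveI : NeZero N := ⟨by omega⟩
  { Work := Unit
    start := (false, 0, 0, ())
    unitaryOp := fun n => groverGate hN enc R t n
    out := fun j => j.2.1 }

lemma sum_ite_mem_solutions (R : Finset (Fin N × Fin N)) (π : Equiv.Perm (Fin N)) (a b : ℂ) :
    ∑ x, (if (x, π x) ∈ R then a else b) =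
      (solutions R π).card * a + (N - (solutions R π).card) * b := by
  have h := card_filter_add_card_filter_not (s := (univ : Finset (Fin N)))
    (fun x => (x, π x) ∈ R)
  rw [card_univ, Fintype.card_fin] at h
  rw [sum_ite, sum_const, sum_const, nsmul_eq_mul, nsmul_eq_mul]
  unfold solutions
  have hc : ((univ.filter fun x => (x, π x) ∈ R).card : ℂ) +
      (univ.filter fun x => (x, π x) ∉ R).card = N := by exact_mod_cast h
  linear_combination b * hc

/-- The angle of the rotation by which an iteration of Grover's algorithm acts. -/
noncomputable def groverAngle (R : Finset (Fin N × Fin N)) (π : Equiv.Perm (Fin N)) : ℝ :=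
  Real.arcsin (√((solutions R π).card / N))

lemma card_solutions_le (R : Finset (Fin N × Fin N)) (π : Equiv.Perm (Fin N)) :
    (solutions R π).card ≤ N :=
  (card_le_univ _).trans_eq (Fintype.card_fin N)

lemma sin_groverAngle (R : Finset (Fin N × Fin N)) (π : Equiv.Perm (Fin N)) :
    Real.sin (groverAngle R π) = √((solutions R π).card / N) := by
  refine Real.sin_arcsin (by linarith [Real.sqrt_nonneg ((solutions R π).card / N : ℝ)]) ?_
  exact Real.sqrt_le_one.2 (div_le_one_of_le₀ (by exact_mod_cast card_solutions_le R π)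
    (Nat.cast_nonneg N))

lemma card_solutions_eq (hN : 0 < N) (R : Finset (Fin N × Fin N)) (π : Equiv.Perm (Fin N)) :
    ((solutions R π).card : ℝ) = N * Real.sin (groverAngle R π) ^ 2 := by
  have : (N : ℝ) ≠ 0 := by exact_mod_cast hN.ne'
  rw [sin_groverAngle, Real.sq_sqrt (by positivity)]
  field_simp

/-- Each iteration rotates by `2θ` in the plane of vectors constant on solutions and on
non-solutions. The amplitudes are kept multiplied by `sin θ` and `cos θ`, so that the cases of no
solution and of only solutions need no division. -/
lemma grover_state_two_mul (hN : 2 ≤ N) (enc : Fin N ↪ Y) (R : Finset (Fin N × Fin N)) (t q : ℕ)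
    (π : Equiv.Perm (Fin N)) (s : ℕ) (hst : s ≤ t) (hs : 2 * s < q + 1) :
    ∃ a b : ℝ, (grover hN enc R t q).state enc π ⟨2 * s, hs⟩ =
        queryState Y (fun x => if (x, π x) ∈ R then (a : ℂ) else b) ∧
      √N * a * Real.sin (groverAngle R π) = Real.sin ((2 * s + 1) * groverAngle R π) ∧
      √N * b * Real.cos (groverAngle R π) = Real.cos ((2 * s + 1) * groverAngle R π) := by
  have : NeZero N := ⟨by omega⟩
  have hN0 : (0 : ℝ) < N := by exact_mod_cast NeZero.pos N
  induction s with
  | zero =>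
    refine ⟨(√N)⁻¹, (√N)⁻¹, ?_, ?_, ?_⟩
    · change (groverGate hN enc R t 0).1.mulVec (Pi.single (false, 0, 0, ()) 1) = _
      rw [groverGate, if_pos rfl, (exists_preparation hN 0).choose_spec]
      congr 1
      funext x
      simp [uniformAmp]
    all_goals
      rw [mul_inv_cancel₀ (Real.sqrt_pos.2 hN0).ne']
      simp
  | succ s ih =>
    obtain ⟨a, b, hab, ha, hb⟩ := ih (by omega) (by omega)
    set θ := groverAngle R π with hθ
    set K : ℝ := ((solutions R π).card : ℝ) with hK
    have hKN : K = N * Real.sin θ ^ 2 := card_solutions_eq (NeZero.pos N) R π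
    -- The mean amplitude once the sign has been applied; diffusion subtracts `2 * μ`.
    set μ : ℝ := (N : ℝ)⁻¹ * (K * a - (N - K) * b) with hμ
    refine ⟨a - 2 * μ, -b - 2 * μ, ?_, ?_, ?_⟩
    · have h1 : (grover hN enc R t q).state enc π ⟨2 * (s + 1), hs⟩ =
          (groverGate hN enc R t (2 * s + 2)).1.mulVec ((oracle enc π).mulVec
            ((groverGate hN enc R t (2 * s + 1)).1.mulVec ((oracle enc π).mulVec
              ((grover hN enc R t q).state enc π ⟨2 * s, by omega⟩)))) := rfl
      have h2 : groverGate hN enc R t (2 * s + 2) = diffusionGate N Y := by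
        rw [groverGate, if_neg (by omega), if_neg (by omega), if_neg (by omega)]
      have h3 : groverGate hN enc R t (2 * s + 1) = signGate enc R := by
        rw [groverGate, if_neg (by omega), if_neg (by omega), if_pos (by omega)]
      have h4 : (fun x => (if (x, π x) ∈ R then (1 : ℂ) else -1) *
          if (x, π x) ∈ R then (a : ℂ) else b) =
          fun x => if (x, π x) ∈ R then (a : ℂ) else -b := by
        funext x
        split_ifs <;> simp
      rw [h1, h2, h3, hab, oracle_signGate_oracle_mulVec, h4, diffusionGate_mulVec,
        sum_ite_mem_solutions]
      congr 1
      funext x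
      rw [hμ, hK]
      push_cast
      split_ifs <;> ring
    all_goals
      have hμ' : μ = Real.sin θ ^ 2 * a - Real.cos θ ^ 2 * b := by
        rw [hμ, hKN, Real.cos_sq']
        field_simp
      have hang : (2 * ((s + 1 : ℕ) : ℝ) + 1) * θ = (2 * s + 1) * θ + 2 * θ := by
        push_cast
        ring
      have hcos := Real.cos_sq' θ
      rw [hang, hμ']
    · rw [Real.sin_add, ← ha, ← hb, Real.sin_two_mul, Real.cos_two_mul]
      linear_combination (-2 * √N * a * Real.sin θ) * hcos
    · rw [Real.cos_add, ← ha, ← hb, Real.sin_two_mul, Real.cos_two_mul]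
      ring

end grover

/-! ### Success probability and choice of the number of iterations -/

section grover

variable {N : ℕ} {Y : Type} [AddCommGroup Y] [DecidableEq Y] [Fintype Y]

lemma sum_oracle_mulVec_filter (enc : Fin N ↪ Y) (π : Equiv.Perm (Fin N)) (x : Fin N)
    (v : Label N Y Unit → ℂ) :
    ∑ j with j.2.1 = x, ‖(oracle enc π).mulVec v j‖ ^ 2 = ∑ j with j.2.1 = x, ‖v j‖ ^ 2 := by
  rw [sum_filter, sum_filter, ← (queryEquiv enc π).sum_comp]
  refine sum_congr rfl fun j _ => ?_
  have h : (queryEquiv enc π j).2.1 = j.2.1 := by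
    obtain ⟨_ | _, x, y, w⟩ := j <;> rfl
  rw [oracle_mulVec, Function.comp_apply, Equiv.symm_apply_apply, h]

/-- The surplus queries, interleaved with identities, only permute labels within a fixed value of
the query register. -/
lemma grover_sum_state_eq (hN : 2 ≤ N) (enc : Fin N ↪ Y) (R : Finset (Fin N × Fin N)) {t q : ℕ}
    (htq : 2 * t < q + 1) (π : Equiv.Perm (Fin N)) (x : Fin N) (k : Fin (q + 1))
    (hk : 2 * t ≤ k.val) :
    (∑ j : Label N Y Unit with j.2.1 = x, ‖(grover hN enc R t q).state enc π k j‖ ^ 2) =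
      ∑ j : Label N Y Unit with j.2.1 = x,
        ‖(grover hN enc R t q).state enc π ⟨2 * t, htq⟩ j‖ ^ 2 := by
  induction k using Fin.induction with
  | zero =>
    obtain rfl : t = 0 := by simpa using hk
    rfl
  | succ i ih =>
    rcases hk.eq_or_lt with h | h
    · rw [show i.succ = ⟨2 * t, htq⟩ from Fin.ext h.symm]
    · rw [← ih (by simpa [Nat.lt_succ_iff] using h)]
      have h1 : (grover hN enc R t q).state enc π i.succ =
          (groverGate hN enc R t i.succ).1.mulVec ((oracle enc π).mulVec
            ((grover hN enc R t q).state enc π i.castSucc)) := QueryAlgorithm.state_succ ..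
      have h2 : groverGate hN enc R t i.succ = 1 := by
        rw [groverGate, if_neg (by simp), if_pos h]
      rw [h2, OneMemClass.coe_one, Matrix.one_mulVec] at h1
      exact (congrArg (fun v : Label N Y Unit → ℂ => ∑ j with j.2.1 = x, ‖v j‖ ^ 2) h1).trans
        (sum_oracle_mulVec_filter enc π x _)

lemma sum_queryState_filter (f : Fin N → ℂ) (x : Fin N) :
    ∑ j with j.2.1 = x, ‖queryState Y f j‖ ^ 2 = ‖f x‖ ^ 2 := by
  rw [sum_filter, sum_queryState]
  · simp [queryState]
  · intro j hj
    simp [queryState, hj]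

/-- Grover's algorithm finds a solution with probability `sin² ((2 t + 1) θ)`. -/
lemma grover_sum_outputProb (hN : 2 ≤ N) (enc : Fin N ↪ Y) (R : Finset (Fin N × Fin N)) {t q : ℕ}
    (htq : 2 * t ≤ q) (π : Equiv.Perm (Fin N)) :
    ∑ x with (x, π x) ∈ R, (grover hN enc R t q).outputProb enc π x =
      Real.sin ((2 * t + 1) * groverAngle R π) ^ 2 := by
  obtain ⟨a, b, hab, ha, -⟩ := grover_state_two_mul hN enc R t q π t le_rfl (by omega)
  have h (x : Fin N) : (grover hN enc R t q).outputProb enc π x =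
      ‖if (x, π x) ∈ R then (a : ℂ) else b‖ ^ 2 := by
    rw [← sum_queryState_filter (Y := Y) (fun x => if (x, π x) ∈ R then (a : ℂ) else b), ← hab]
    exact grover_sum_state_eq hN enc R (by omega) π x (Fin.last q) htq
  have h' (x) (hx : x ∈ univ.filter fun x => (x, π x) ∈ R) :
      (grover hN enc R t q).outputProb enc π x = a ^ 2 := by
    rw [h, if_pos (mem_filter.1 hx).2, Complex.norm_real, Real.norm_eq_abs, sq_abs]
  rw [sum_congr rfl h', sum_const, nsmul_eq_mul, ← ha]
  change ((solutions R π).card : ℝ) * a ^ 2 = _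
  rw [card_solutions_eq (by omega) R π, mul_pow, mul_pow, Real.sq_sqrt (Nat.cast_nonneg N)]
  ring

lemma grover_successProb (hN : 2 ≤ N) (enc : Fin N ↪ Y) (R : Finset (Fin N × Fin N)) {t q : ℕ}
    (htq : 2 * t ≤ q) :
    (grover hN enc R t q).successProb enc R =
      (∑ π, Real.sin ((2 * t + 1) * groverAngle R π) ^ 2) /
        Fintype.card (Equiv.Perm (Fin N)) := by
  rw [QueryAlgorithm.successProb, sum_congr rfl fun π _ => grover_sum_outputProb hN enc R htq π]

variable {r : ℕ}

/-- Without iterations the output is a uniform guess, correct with probability the mean of `K / N`.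
-/
lemma grover_zero_successProb [NeZero N] (hN : 2 ≤ N) (hr : r ≤ N) (enc : Fin N ↪ Y) (q : ℕ) :
    (grover hN enc (cyclicRel N r) 0 q).successProb enc (cyclicRel N r) = r / N := by
  have hN0 : (0 : ℝ) < N := by exact_mod_cast NeZero.pos N
  have hF : (0 : ℝ) < Fintype.card (Equiv.Perm (Fin N)) := by exact_mod_cast Fintype.card_pos
  rw [grover_successProb hN enc _ (by omega), div_eq_div_iff hF.ne' hN0.ne']
  have h := sum_card_solutions (cyclicRel N r)
  simp_rw [fun π => card_solutions_eq (NeZero.pos N) (cyclicRel N r) π] at h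
  rw [← mul_sum, card_cyclicRel hr, Nat.cast_mul, mul_assoc] at h
  have h' := mul_left_cancel₀ hN0.ne' h
  simp only [Nat.cast_zero, mul_zero, zero_add, one_mul]
  linarith

lemma le_grover_successProb [NeZero N] (hN : 2 ≤ N) (hr : r ≤ N) (enc : Fin N ↪ Y) {t q : ℕ}
    (htq : 2 * t ≤ q) :
    (2 * (t : ℝ) + 1) ^ 2 * (r / N) - 12 * ((2 * (t : ℝ) + 1) ^ 2 * (r / N)) ^ 2 ≤
      (grover hN enc (cyclicRel N r) t q).successProb enc (cyclicRel N r) := by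
  have hN0 : (0 : ℝ) < N := by exact_mod_cast NeZero.pos N
  have hF : (0 : ℝ) < Fintype.card (Equiv.Perm (Fin N)) := by exact_mod_cast Fintype.card_pos
  set F : ℝ := (Fintype.card (Equiv.Perm (Fin N)) : ℝ) with hFdef
  set m : ℝ := 2 * (t : ℝ) + 1 with hm
  have hm0 : 0 ≤ m := by positivity
  rw [grover_successProb hN enc _ htq, le_div_iff₀ hF]
  have h1 (π : Equiv.Perm (Fin N)) :
      m ^ 2 * ((solutions (cyclicRel N r) π).card / N) -
        4 * (m ^ 2 * ((solutions (cyclicRel N r) π).card / N)) ^ 2 ≤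
      Real.sin (m * groverAngle (cyclicRel N r) π) ^ 2 :=
    le_sin_sq_mul_arcsin_sqrt (by positivity)
      (div_le_one_of_le₀ (by exact_mod_cast card_solutions_le _ π) hN0.le) hm0
  refine le_trans ?_ (sum_le_sum fun π _ => h1 π)
  have h2 : ∑ π, ((solutions (cyclicRel N r) π).card : ℝ) = r * F := by
    have h := sum_card_solutions (cyclicRel N r)
    rw [card_cyclicRel hr, Nat.cast_mul, mul_assoc] at h
    exact mul_left_cancel₀ hN0.ne' h
  have h3 : ∑ π, ((solutions (cyclicRel N r) π).card : ℝ) ^ 2 ≤ 3 * r ^ 2 * F := by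
    have h := sum_card_solutions_sq_le (cyclicRel N r)
    rw [card_cyclicRel hr, Nat.cast_mul] at h
    -- Integrality of `r` absorbs the diagonal term `r` into `r ^ 2`, whence `3 r²` and the constant
    -- `12 = 4 * 3`.
    have hr2 : (r : ℝ) ≤ r ^ 2 := by exact_mod_cast Nat.le_self_pow two_ne_zero r
    refine le_of_mul_le_mul_left (h.trans ?_) (by positivity : (0 : ℝ) < (N : ℝ) ^ 2)
    calc _ = (N : ℝ) ^ 2 * ((r + 2 * r ^ 2) * F) := by ring
      _ ≤ (N : ℝ) ^ 2 * ((r ^ 2 + 2 * r ^ 2) * F) := by gcongr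
      _ = _ := by ring
  have h4 : ∑ π, (m ^ 2 * ((solutions (cyclicRel N r) π).card / N) -
        4 * (m ^ 2 * ((solutions (cyclicRel N r) π).card / N)) ^ 2) =
      m ^ 2 / N * ∑ π, ((solutions (cyclicRel N r) π).card : ℝ) -
        4 * (m ^ 2 / N) ^ 2 * ∑ π, ((solutions (cyclicRel N r) π).card : ℝ) ^ 2 := by
    rw [mul_sum, mul_sum, ← sum_sub_distrib]
    exact sum_congr rfl fun π _ => by ring
  rw [h4, h2]
  calc _ = m ^ 2 / N * (r * F) - 4 * (m ^ 2 / N) ^ 2 * (3 * r ^ 2 * F) := by ring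
    _ ≤ _ := by gcongr

/-- A number of iterations for which the rotation stays below a constant angle and which is
optimal up to a constant factor. -/
lemma exists_iterations {l : ℝ} (hl0 : 0 ≤ l) (hl : l ≤ 1 / 24) (q : ℕ) :
    ∃ t : ℕ, 2 * t ≤ q ∧ (2 * (t : ℝ) + 1) ^ 2 * l ≤ 1 / 24 ∧
      1 / 2048 * min 1 (8 * (8 * (q : ℝ) + 1) ^ 2 * l) ≤ (2 * (t : ℝ) + 1) ^ 2 * l := by
  by_cases hq : (2 * ((q / 2 : ℕ) : ℝ) + 1) ^ 2 * l ≤ 1 / 24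
  · refine ⟨q / 2, by omega, hq, ?_⟩
    -- The ratio 16 gives `8 * 16 ^ 2 = 2048`.
    have h1 : (8 * (q : ℝ) + 1) ≤ 16 * (2 * ((q / 2 : ℕ) : ℝ) + 1) := by
      exact_mod_cast (by omega : 8 * q + 1 ≤ 16 * (2 * (q / 2) + 1))
    calc _ ≤ 1 / 2048 * (8 * (8 * (q : ℝ) + 1) ^ 2 * l) := by gcongr; exact min_le_right _ _
      _ ≤ 1 / 2048 * (8 * (16 * (2 * ((q / 2 : ℕ) : ℝ) + 1)) ^ 2 * l) := by gcongr
      _ = _ := by ring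
  · have hex : ∃ n : ℕ, ¬ (2 * (n : ℝ) + 1) ^ 2 * l ≤ 1 / 24 := ⟨_, hq⟩
    classical
    have hn := Nat.find_spec hex
    have hmin := fun k => Nat.find_min hex (m := k)
    have hle := Nat.find_min' hex hq
    generalize Nat.find hex = n at hn hmin hle
    -- The least excessive count is positive because `l ≤ 1 / 24`; its predecessor is used.
    rcases n with _ | t
    · simp at hn
      linarith
    refine ⟨t, by omega, not_not.1 (hmin t (by omega)), ?_⟩
    push Not at hn
    -- One more iteration at most triples `2 t + 1`, so the value at `t` still exceeds `1 / 216`.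
    have h1 : (2 * ((t + 1 : ℕ) : ℝ) + 1) ^ 2 * l ≤ 9 * ((2 * (t : ℝ) + 1) ^ 2 * l) := by
      rw [← mul_assoc]
      gcongr
      push_cast
      have : (0 : ℝ) ≤ t := Nat.cast_nonneg t
      nlinarith
    have h2 := min_le_left (1 : ℝ) (8 * (8 * (q : ℝ) + 1) ^ 2 * l)
    linarith

end grover

end PermSearch

theorem mainTheorem5 :
    (∀ (N : ℕ), 2 ≤ N →
      ∀ (Y : Type) [AddCommGroup Y] [Fintype Y] [DecidableEq Y] (enc : Fin N ↪ Y)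
        (R : Finset (Fin N × Fin N)) (q : ℕ) (A : PermSearch.QueryAlgorithm N Y q),
        A.successProb enc R ≤ 8 * (8 * (q : ℝ) + 1) ^ 2 * (PermSearch.rMax R : ℝ) / (N : ℝ)) ∧
    (∃ c : ℝ, 0 < c ∧
      ∀ (N : ℕ), 2 ≤ N → ∀ r : ℕ, r ≤ N →
        ∃ R : Finset (Fin N × Fin N), PermSearch.rMax R = r ∧
          ∀ (Y : Type) [AddCommGroup Y] [Fintype Y] [DecidableEq Y] (enc : Fin N ↪ Y) (q : ℕ),
            ∃ A : PermSearch.QueryAlgorithm N Y q,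
              c * min 1 (8 * (8 * (q : ℝ) + 1) ^ 2 * (r : ℝ) / (N : ℝ)) ≤
                A.successProb enc R) := by
  constructor
  · intro N hN Y _ _ _ enc R q A
    refine (A.successProb_le_of_pos enc (by omega) R).trans ?_
    gcongr
    nlinarith [(Nat.cast_nonneg q : (0 : ℝ) ≤ q)]
  -- Half of `1 / 2048`: when `m² l ≤ 1 / 24`, the loss `12 (m² l)²` is at most half of `m² l`.
  · refine ⟨1 / 4096, by norm_num, fun N hN r hr => ?_⟩
    have : NeZero N := ⟨by omega⟩
    refine ⟨PermSearch.cyclicRel N r, PermSearch.rMax_cyclicRel hr, fun Y _ _ _ enc q => ?_⟩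
    rw [mul_div_assoc]
    set l : ℝ := (r : ℝ) / N with hl
    have hl0 : 0 ≤ l := by positivity
    rcases le_or_gt l (1 / 24) with h | h
    · obtain ⟨t, htq, ht1, ht2⟩ := PermSearch.exists_iterations hl0 h q
      refine ⟨PermSearch.grover hN enc (PermSearch.cyclicRel N r) t q, ?_⟩
      refine le_trans ?_ (PermSearch.le_grover_successProb hN hr enc htq)
      have h0 : 0 ≤ (2 * (t : ℝ) + 1) ^ 2 * l := by positivity
      nlinarith
    · refine ⟨PermSearch.grover hN enc (PermSearch.cyclicRel N r) 0 q, ?_⟩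
      rw [PermSearch.grover_zero_successProb hN hr enc q, ← hl]
      have := min_le_left (1 : ℝ) (8 * (8 * (q : ℝ) + 1) ^ 2 * l)
      linarith
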